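/- Let $0\le r\le 1$ and put $u=\frac{1-r}{1+r}\in[0,1]$. Let $S=\{(d_1,d_2)\in[0,1]^2 : d_1+d_2\le 1\}$, and for $\mathbf d=(d_1,d_2)\in\mathbb R^2$ write $|\mathbf d|_{\rm abs}=(|d_1|,|d_2|)$. (Best-of-three.) Define $T:\mathbb R^2\to\mathbb R^2$ by $$T(d_1,d_2)=\Bigl(\tfrac{ud_1}{2}\bigl(3-(ud_1)^2-3d_2^2\bigr),\ \tfrac{d_2}{2}\bigl(3-3(ud_1)^2-d_2^2\bigr)\Bigr),$$ and the points $\mathbf d^*_1=(0,0)$; $\mathbf d^*_2=\bigl(\sqrt{(3u-2)/u^3},0\bigr)$, defined only if $u\ge\frac23$; $\mathbf d^*_3=\bigl(\sqrt{1/(4u^3)},\sqrt{(4u-3)/(4u)}\bigr)$, defined only if $u\ge\frac34$; $\mathbf d^*_4=(0,1)$. Let $(\mathbf d^{(t)})_{t\ge0}$ be any sequence with $|\mathbf d^{(0)}|_{\rm abs}\in S$ and $\mathbf d^{(t+1)}=T(\mathbf d^{(t)})$ for all $t\ge 0$. Then $\lim_{t\to\infty}|\mathbf d^{(t)}|_{\rm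 abs}=\mathbf d^*_i$ for some $i\in\{1,2,3,4\}$ for which $\mathbf d^*_i$ is defined. If in addition $u<\frac34$ (equivalently $r>\frac17$) and $|d^{(0)}_2|>\kappa$ for some $\kappa>0$, then $\lim_{t\to\infty}|\mathbf d^{(t)}|_{\rm abs}=\mathbf d^*_4=(0,1)$. (Best-of-two.) The same holds for $$T(d_1,d_2)=\Bigl(\tfrac{d_1}{2}\bigl((2u+1)-(ud_1)^2-(2u+1)d_2^2\bigr),\ \tfrac{d_2}{2}\bigl(3-u(2+u)d_1^2-d_2^2\bigr)\Bigr)$$ with $\mathbf d^*_1=(0,0)$; $\mathbf d^*_2=\bigl(\sqrt{(2u-1)/u^2},0\bigr)$, defined only if $u\ge\frac12$; $\mathbf d^*_3=\Bigl(\sqrt{\tfrac{1}{u(u+1)^2}},\sqrt{\tfrac{u^2+u-1}{(u+1)^2}}\Bigr)$, defined only if $u\ge\frac{\sqrt5-1}{2}$; $\mathbf d^*_4=(0,1)$; and with the condition $u<\frac34$ replaced by $u<\frac{\sqrt5-1}{2}$ (equivalently $r>\sqrt5-2$). -/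

import Mathlib

open Filter Topology

noncomputable section

namespace BestOf

/-- The parameter `u = (1 - r) / (1 + r)` attached to the density ratio `r = q / p`. -/
def uOf (r : ℝ) : ℝ := (1 - r) / (1 + r)

/-- The triangle `S = {(d₁, d₂) ∈ [0,1]² : d₁ + d₂ ≤ 1}`. -/
def S : Set (ℝ × ℝ) :=
  {d | d.1 ∈ Set.Icc (0 : ℝ) 1 ∧ d.2 ∈ Set.Icc (0 : ℝ) 1 ∧ d.1 + d.2 ≤ 1}

/-- The coordinatewise absolute value of a point of the plane. -/
def absPt (d : ℝ × ℝ) : ℝ × ℝ := (|d.1|, |d.2|)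

/-- The map induced by Best-of-three, in the coordinates
`(δ₁, δ₂) = (α₁ - α₂, α₁ + α₂ - 1)`. -/
def T3 (u : ℝ) (d : ℝ × ℝ) : ℝ × ℝ :=
  (u * d.1 / 2 * (3 - (u * d.1) ^ 2 - 3 * d.2 ^ 2),
   d.2 / 2 * (3 - 3 * (u * d.1) ^ 2 - d.2 ^ 2))

/-- The map induced by Best-of-two, in the same coordinates. -/
def T2 (u : ℝ) (d : ℝ × ℝ) : ℝ × ℝ :=
  (d.1 / 2 * ((2 * u + 1) - (u * d.1) ^ 2 - (2 * u + 1) * d.2 ^ 2),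
   d.2 / 2 * (3 - u * (2 + u) * d.1 ^ 2 - d.2 ^ 2))

/-- The consensus point `d*₄`. -/
def consensus : ℝ × ℝ := (0, 1)

/-- The points `d*₁, d*₂, d*₃, d*₄` for Best-of-three; `d*₂` and `d*₃` are present only for
`u ≥ 2/3` and `u ≥ 3/4` respectively. -/
def starPts3 (u : ℝ) : Set (ℝ × ℝ) :=
  {z | z = (0, 0)
    ∨ (2 / 3 ≤ u ∧ z = (√((3 * u - 2) / u ^ 3), 0))
    ∨ (3 / 4 ≤ u ∧ z = (√(1 / (4 * u ^ 3)), √((4 * u - 3) / (4 * u))))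
    ∨ z = consensus}

/-- The points `d*₁, d*₂, d*₃, d*₄` for Best-of-two; `d*₂` and `d*₃` are present only for
`u ≥ 1/2` and `u ≥ (√5 - 1)/2` respectively. -/
def starPts2 (u : ℝ) : Set (ℝ × ℝ) :=
  {z | z = (0, 0)
    ∨ (1 / 2 ≤ u ∧ z = (√((2 * u - 1) / u ^ 2), 0))
    ∨ ((√5 - 1) / 2 ≤ u ∧
        z = (√(1 / (u * (u + 1) ^ 2)), √((u ^ 2 + u - 1) / (u + 1) ^ 2)))
    ∨ z = consensus}

end BestOf

end

/-! Both maps are instances of one cubic family. On the triangle `S` the map is competitive: it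
preserves the order in which `d₁` rises and `d₂` falls. It also never strictly reverses both
coordinates of a strictly ordered pair, since a weighted sum of the coordinates is monotone. Every
orbit is therefore eventually monotone in each coordinate and converges to a fixed point, and
solving the fixed-point equations gives the starred points. Below the threshold on `u`, every fixed
point other than consensus lies on the axis `d₂ = 0` and repels transversally, so an orbit starting
off the axis reaches consensus. Signs play no role, because the map commutes with `absPt`. -/

namespace BestOf

/-- The common form of the Best-of-two and Best-of-three maps. -/
noncomputable def cubicMap (c α γ : ℝ) (d : ℝ × ℝ) : ℝ × ℝ :=
  (d.1 / 2 * (c * (1 - d.2 ^ 2) - α * d.1 ^ 2), d.2 / 2 * (3 - γ * d.1 ^ 2 - d.2 ^ 2))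

/-- The conditions on the coefficients under which `cubicMap` preserves the triangle `S` and is
competitive and orientation preserving there. -/
structure Admissible (c α γ : ℝ) : Prop where
  c_nonneg : 0 ≤ c
  c_le : c ≤ 3
  α_nonneg : 0 ≤ α
  α_le : 3 * α ≤ c
  γ_nonneg : 0 ≤ γ
  γ_le : γ ≤ 3
  two_c_le : 2 * c ≤ 3 + γ
  c_le_add : c ≤ 2 + α

theorem T3_eq_cubicMap (u : ℝ) : T3 u = cubicMap (3 * u) (u ^ 3) (3 * u ^ 2) := by
  funext d
  ext <;> (simp only [T3, cubicMap]; ring)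

theorem T2_eq_cubicMap (u : ℝ) : T2 u = cubicMap (2 * u + 1) (u ^ 2) (u * (2 + u)) := by
  funext d
  ext
  · simp only [T2, cubicMap]
    ring
  · rfl

theorem admissible_three {u : ℝ} (h0 : 0 ≤ u) (h1 : u ≤ 1) :
    Admissible (3 * u) (u ^ 3) (3 * u ^ 2) where
  c_nonneg := by positivity
  c_le := by linarith
  α_nonneg := by positivity
  α_le := by nlinarith [mul_nonneg h0 (sub_nonneg.2 h1), mul_nonneg (sq_nonneg u) (sub_nonneg.2 h1)]
  γ_nonneg := by positivity
  γ_le := by nlinarith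
  two_c_le := by nlinarith [sq_nonneg (u - 1)]
  c_le_add := by nlinarith [mul_nonneg (sq_nonneg (u - 1)) (by linarith : 0 ≤ u + 2)]

theorem admissible_two {u : ℝ} (h0 : 0 ≤ u) (h1 : u ≤ 1) :
    Admissible (2 * u + 1) (u ^ 2) (u * (2 + u)) where
  c_nonneg := by positivity
  c_le := by linarith
  α_nonneg := by positivity
  α_le := by nlinarith
  γ_nonneg := by positivity
  γ_le := by nlinarith
  two_c_le := by nlinarith [sq_nonneg (u - 1)]
  c_le_add := by nlinarith [sq_nonneg (u - 1)]

theorem mem_S_iff {d : ℝ × ℝ} : d ∈ S ↔ 0 ≤ d.1 ∧ 0 ≤ d.2 ∧ d.1 + d.2 ≤ 1 := by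
  simp only [S, Set.mem_ofPred_eq, Set.mem_Icc]
  constructor
  · rintro ⟨⟨h1, -⟩, ⟨h2, -⟩, h⟩
    exact ⟨h1, h2, h⟩
  · rintro ⟨h1, h2, h⟩
    exact ⟨⟨h1, by linarith⟩, ⟨h2, by linarith⟩, h⟩

theorem sq_add_le_one {x y : ℝ} (hx : 0 ≤ x) (hy : 0 ≤ y) (h : x + y ≤ 1) :
    x ^ 2 + 2 * (x * y) + y ^ 2 ≤ 1 := by
  nlinarith

/-! ### Invariance and order properties of the cubic map on the triangle. -/

section Cubic

variable {c α γ : ℝ}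

theorem continuous_cubicMap : Continuous (cubicMap c α γ) := by
  unfold cubicMap
  fun_prop

theorem Admissible.fst_factor_nonneg (H : Admissible c α γ) {x y : ℝ} (hx : 0 ≤ x) (hy : 0 ≤ y)
    (h : x + y ≤ 1) : 0 ≤ c * (1 - y ^ 2) - α * x ^ 2 := by
  have hq : x ^ 2 ≤ 1 - y ^ 2 := by nlinarith [sq_add_le_one hx hy h, mul_nonneg hx hy]
  nlinarith [mul_le_mul_of_nonneg_left hq H.c_nonneg, H.α_le, H.α_nonneg,
    mul_nonneg (sub_nonneg.2 (show α ≤ c by linarith [H.α_le, H.α_nonneg])) (sq_nonneg x)]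

/-- The bound `2 * y`, rather than `0`, keeps a positive second coordinate positive. -/
theorem Admissible.two_mul_le_snd_factor (H : Admissible c α γ) {x y : ℝ} (hx : 0 ≤ x)
    (hy : 0 ≤ y) (h : x + y ≤ 1) : 2 * y ≤ 3 - γ * x ^ 2 - y ^ 2 := by
  nlinarith [mul_nonneg (sub_nonneg.2 H.γ_le) (sq_nonneg x), mul_nonneg hx (by linarith : 0 ≤ 1 - x),
    mul_nonneg hy (by linarith : 0 ≤ 1 - y)]

theorem Admissible.sum_le_one (H : Admissible c α γ) {x y : ℝ} (hx : 0 ≤ x) (hy : 0 ≤ y)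
    (h : x + y ≤ 1) :
    x / 2 * (c * (1 - y ^ 2) - α * x ^ 2) + y / 2 * (3 - γ * x ^ 2 - y ^ 2) ≤ 1 := by
  obtain ⟨z, rfl⟩ : ∃ z, x = 1 - z := ⟨1 - x, by ring⟩
  have hyz : y ≤ z := by linarith
  -- the value increases when `y` is raised to `z = 1 - x`
  have step : 0 ≤ (z - y) * (3 - γ * (1 - z) ^ 2 - (z ^ 2 + z * y + y ^ 2)
      - c * (1 - z) * (z + y)) := by
    refine mul_nonneg (by linarith) ?_
    have e1 : z ^ 2 + z * y + y ^ 2 ≤ 3 * z ^ 2 := by nlinarith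
    have e2 : c * (1 - z) * (z + y) ≤ 3 * (1 - z) * (2 * z) := by
      have := H.c_nonneg
      have := H.c_le
      have : 0 ≤ z + y := by linarith
      have : z + y ≤ 2 * z := by linarith
      gcongr
    nlinarith [mul_nonneg (sub_nonneg.2 H.γ_le) (sq_nonneg (1 - z))]
  -- On the hypotenuse `y = z`, twice the gap between 1 and the sum equals this product.
  have edge : 0 ≤ (1 - z) ^ 2 * ((3 + γ - 2 * c) * z + (2 + α - c) * (1 - z)) := by
    have := H.two_c_le
    have := H.c_le_add
    exact mul_nonneg (sq_nonneg _)
      (add_nonneg (mul_nonneg (by linarith) (by linarith)) (mul_nonneg (by linarith) hx))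
  nlinarith

theorem Admissible.mapsTo (H : Admissible c α γ) {d : ℝ × ℝ} (hd : d ∈ S) :
    cubicMap c α γ d ∈ S := by
  obtain ⟨hx, hy, h⟩ := mem_S_iff.1 hd
  refine mem_S_iff.2 ⟨mul_nonneg (by positivity) (H.fst_factor_nonneg hx hy h),
    mul_nonneg (by positivity) ?_, H.sum_le_one hx hy h⟩
  linarith [H.two_mul_le_snd_factor hx hy h]

theorem Admissible.absPt_cubicMap (H : Admissible c α γ) {d : ℝ × ℝ} (hd : absPt d ∈ S) :
    absPt (cubicMap c α γ d) = cubicMap c α γ (absPt d) := by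
  obtain ⟨hx, hy, h⟩ := mem_S_iff.1 hd
  have h1 := H.fst_factor_nonneg hx hy h
  have h2 : 0 ≤ 3 - γ * |d.1| ^ 2 - |d.2| ^ 2 :=
    (mul_nonneg zero_le_two hy).trans (H.two_mul_le_snd_factor hx hy h)
  simp only [absPt, sq_abs] at h1 h2 ⊢
  simp only [cubicMap, sq_abs, abs_mul, abs_div, abs_of_nonneg h1, abs_of_nonneg h2, abs_two]

/-- Raise `x` to `x'` at height `y'`, where the hypothesis bounds the derivative; then lower `y` to
`y'`. -/
theorem cubic_mono {a b k x x' y y' : ℝ} (ha : 0 ≤ a) (hb : 0 ≤ b) (hx : 0 ≤ x) (hxx : x ≤ x')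
    (hy : 0 ≤ y') (hyy : y' ≤ y) (h : 3 * a * x' ^ 2 + b * y' ^ 2 ≤ k) :
    x * (k - a * x ^ 2 - b * y ^ 2) ≤ x' * (k - a * x' ^ 2 - b * y' ^ 2) := by
  have e : x' ^ 2 + x * x' + x ^ 2 ≤ 3 * x' ^ 2 := by nlinarith
  have h1 : 0 ≤ (x' - x) * (k - a * (x' ^ 2 + x * x' + x ^ 2) - b * y' ^ 2) := by
    refine mul_nonneg (by linarith) ?_
    nlinarith [mul_le_mul_of_nonneg_left e ha]
  have h2 : 0 ≤ x * (b * (y ^ 2 - y' ^ 2)) :=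
    mul_nonneg hx (mul_nonneg hb (by nlinarith))
  nlinarith

theorem Admissible.competitive (H : Admissible c α γ) {a b : ℝ × ℝ} (ha : a ∈ S) (hb : b ∈ S)
    (h1 : a.1 ≤ b.1) (h2 : b.2 ≤ a.2) :
    (cubicMap c α γ a).1 ≤ (cubicMap c α γ b).1 ∧ (cubicMap c α γ b).2 ≤ (cubicMap c α γ a).2 := by
  obtain ⟨hx, hy, h⟩ := mem_S_iff.1 ha
  obtain ⟨hx', hy', h'⟩ := mem_S_iff.1 hb
  have qa : a.1 ^ 2 ≤ 1 - a.2 ^ 2 := by nlinarith [sq_add_le_one hx hy h, mul_nonneg hx hy]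
  have qb : b.1 ^ 2 ≤ 1 - b.2 ^ 2 := by nlinarith [sq_add_le_one hx' hy' h', mul_nonneg hx' hy']
  have k1 := cubic_mono (k := c) H.α_nonneg H.c_nonneg hx h1 hy' h2 (by
    nlinarith [mul_le_mul_of_nonneg_left qb H.c_nonneg,
      mul_nonneg (sub_nonneg.2 H.α_le) (sq_nonneg b.1)])
  have k2 := cubic_mono (k := 3) zero_le_one H.γ_nonneg hy' h2 hx h1 (by
    nlinarith [mul_nonneg (sub_nonneg.2 H.γ_le) (sq_nonneg a.1)])
  simp only [cubicMap]
  constructor <;> linarith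

/-- With weights 3 and `c`, both partial derivatives are at least nonnegative multiples of `1 - (x +
y) ^ 2`, by `3 * α ≤ c` and `γ ≤ 3`. -/
theorem Admissible.weighted_sum_mono (H : Admissible c α γ) {a b : ℝ × ℝ} (ha : a ∈ S)
    (hb : b ∈ S) (h1 : a.1 ≤ b.1) (h2 : a.2 ≤ b.2) :
    3 * (cubicMap c α γ a).1 + c * (cubicMap c α γ a).2 ≤
      3 * (cubicMap c α γ b).1 + c * (cubicMap c α γ b).2 := by
  obtain ⟨x, y⟩ := a
  obtain ⟨x', y'⟩ := b
  obtain ⟨hx, hy, -⟩ := mem_S_iff.1 ha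
  obtain ⟨hx', hy', h'⟩ := mem_S_iff.1 hb
  simp only at hx hy hx' hy' h' h1 h2
  have q1 := sq_add_le_one hx' hy (by linarith)
  have q2 := sq_add_le_one hx' hy' h'
  have hc := H.c_nonneg
  have hα := H.α_nonneg
  have hγ := H.γ_nonneg
  have s1 : 0 ≤ (x' - x) * (3 * c * (1 - y ^ 2) - 3 * α * (x' ^ 2 + x * x' + x ^ 2)
      - c * γ * y * (x + x')) := by
    refine mul_nonneg (by linarith) ?_
    have e1 : 3 * α * (x' ^ 2 + x * x' + x ^ 2) ≤ 3 * α * (3 * x' ^ 2) :=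
      mul_le_mul_of_nonneg_left (by nlinarith) (by positivity)
    have e2 : c * γ * y * (x + x') ≤ c * 3 * y * (2 * x') := by
      have := H.γ_le
      gcongr
      linarith
    nlinarith [mul_le_mul_of_nonneg_left q1 hc, mul_nonneg (sub_nonneg.2 H.α_le) (sq_nonneg x')]
  have s2 : 0 ≤ c * ((y' - y) * (3 - γ * x' ^ 2 - (y' ^ 2 + y * y' + y ^ 2)
      - 3 * x' * (y + y'))) := by
    refine mul_nonneg hc (mul_nonneg (by linarith) ?_)
    nlinarith [mul_nonneg (sub_nonneg.2 H.γ_le) (sq_nonneg x'), mul_le_mul_of_nonneg_left h2 hx']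
  simp only [cubicMap]
  linarith

end Cubic

/-! ### Convergence of competitive planar orbits. -/

section PlanarDynamics

theorem exists_tendsto_of_eventually_monotone {x : ℕ → ℝ} {N : ℕ} (hb : ∀ n, x n ≤ 1)
    (h : ∀ n ≥ N, x n ≤ x (n + 1)) : ∃ l, Tendsto x atTop (𝓝 l) := by
  have hm : Monotone fun n => x (n + N) :=
    monotone_nat_of_le_succ fun n => by
      simpa [Nat.add_right_comm] using h (n + N) (Nat.le_add_left _ _)
  have hbdd : BddAbove (Set.range fun n => x (n + N)) := ⟨1, by rintro _ ⟨n, rfl⟩; exact hb _⟩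
  exact ⟨_, (tendsto_add_atTop_iff_nat N).1 (tendsto_atTop_ciSup hm hbdd)⟩

theorem exists_tendsto_of_eventually_antitone {x : ℕ → ℝ} {N : ℕ} (hb : ∀ n, 0 ≤ x n)
    (h : ∀ n ≥ N, x (n + 1) ≤ x n) : ∃ l, Tendsto x atTop (𝓝 l) := by
  obtain ⟨l, hl⟩ := exists_tendsto_of_eventually_monotone (x := fun n => 1 - x n) (N := N)
    (fun n => by linarith [hb n]) (fun n hn => by linarith [h n hn])
  exact ⟨1 - l, by simpa using hl.const_sub 1⟩

/-- An orbit of a competitive, orientation preserving map of the triangle `S` is eventually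
monotone in each coordinate, hence converges. -/
theorem exists_tendsto_of_competitive {T : ℝ × ℝ → ℝ × ℝ} {p : ℕ → ℝ × ℝ}
    (hpS : ∀ t, p t ∈ S) (hp : ∀ t, p (t + 1) = T (p t))
    (hcomp : ∀ a ∈ S, ∀ b ∈ S, a.1 ≤ b.1 → b.2 ≤ a.2 → (T a).1 ≤ (T b).1 ∧ (T b).2 ≤ (T a).2)
    (hor : ∀ a ∈ S, ∀ b ∈ S, a.1 < b.1 → a.2 < b.2 → ¬((T b).1 < (T a).1 ∧ (T b).2 < (T a).2)) :
    ∃ z, Tendsto p atTop (𝓝 z) := by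
  have hS t := mem_S_iff.1 (hpS t)
  suffices (∃ l, Tendsto (fun t => (p t).1) atTop (𝓝 l)) ∧
      ∃ l, Tendsto (fun t => (p t).2) atTop (𝓝 l) by
    obtain ⟨⟨l, hl⟩, m, hm⟩ := this
    exact ⟨(l, m), hl.prodMk_nhds hm⟩
  have u1 t : (p t).1 ≤ 1 := by linarith [hS t]
  have u2 t : (p t).2 ≤ 1 := by linarith [hS t]
  have l1 t : 0 ≤ (p t).1 := (hS t).1
  have l2 t : 0 ≤ (p t).2 := (hS t).2.1
  -- A south-east step forces all later steps south-east by competitiveness; likewise for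
  -- north-west.
  by_cases hSE : ∃ N, (p N).1 ≤ (p (N + 1)).1 ∧ (p (N + 1)).2 ≤ (p N).2
  · obtain ⟨N, hN⟩ := hSE
    have key : ∀ n ≥ N, (p n).1 ≤ (p (n + 1)).1 ∧ (p (n + 1)).2 ≤ (p n).2 := by
      intro n hn
      induction n, hn using Nat.le_induction with
      | base => exact hN
      | succ n _ ih =>
        rw [hp (n + 1)]
        nth_rewrite 1 [hp n]
        nth_rewrite 3 [hp n]
        exact hcomp _ (hpS _) _ (hpS _) ih.1 ih.2
    exact ⟨exists_tendsto_of_eventually_monotone u1 fun n hn => (key n hn).1,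
      exists_tendsto_of_eventually_antitone l2 fun n hn => (key n hn).2⟩
  by_cases hNW : ∃ N, (p (N + 1)).1 ≤ (p N).1 ∧ (p N).2 ≤ (p (N + 1)).2
  · obtain ⟨N, hN⟩ := hNW
    have key : ∀ n ≥ N, (p (n + 1)).1 ≤ (p n).1 ∧ (p n).2 ≤ (p (n + 1)).2 := by
      intro n hn
      induction n, hn using Nat.le_induction with
      | base => exact hN
      | succ n _ ih =>
        have := hcomp _ (hpS _) _ (hpS _) ih.1 ih.2
        rwa [← hp, ← hp] at this
    exact ⟨exists_tendsto_of_eventually_antitone l1 fun n hn => (key n hn).1,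
      exists_tendsto_of_eventually_monotone u2 fun n hn => (key n hn).2⟩
  -- Every step is now strictly north-east or strictly south-west, and `hor` forbids passing from
  -- the former to the latter.
  push Not at hSE hNW
  by_cases hNE : ∃ N, (p N).1 < (p (N + 1)).1 ∧ (p N).2 < (p (N + 1)).2
  · obtain ⟨N, hN⟩ := hNE
    have key : ∀ n ≥ N, (p n).1 < (p (n + 1)).1 ∧ (p n).2 < (p (n + 1)).2 := by
      intro n hn
      induction n, hn using Nat.le_induction with
      | base => exact hN
      | succ n _ ih =>
        have := hor _ (hpS _) _ (hpS _) ih.1 ih.2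
        rw [← hp, ← hp] at this
        rcases le_or_gt (p (n + 1)).1 (p (n + 1 + 1)).1 with h | h
        · have h2 := hSE _ h
          exact ⟨lt_of_not_ge fun h' => absurd h2 (hNW _ h').not_gt, h2⟩
        · exact absurd ⟨h, hNW _ h.le⟩ this
    exact ⟨exists_tendsto_of_eventually_monotone u1 fun n hn => (key n hn).1.le,
      exists_tendsto_of_eventually_monotone u2 fun n hn => (key n hn).2.le⟩
  · push Not at hNE
    have key n : (p (n + 1)).1 ≤ (p n).1 := le_of_not_gt fun h =>
      absurd (hSE n h.le) (hNE n h).not_gt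
    exact ⟨exists_tendsto_of_eventually_antitone (N := 0) l1 fun n _ => key n,
      exists_tendsto_of_eventually_antitone (N := 0) l2 fun n _ => (hNW n (key n)).le⟩

end PlanarDynamics

/-! ### Limits of orbits and repulsion from the axis. -/

section Orbits

variable {c α γ : ℝ} {p : ℕ → ℝ × ℝ}

theorem Admissible.orbit_mem (H : Admissible c α γ) (h0 : p 0 ∈ S)
    (hp : ∀ t, p (t + 1) = cubicMap c α γ (p t)) (t : ℕ) : p t ∈ S := by
  induction t with
  | zero => exact h0
  | succ t ih => exact hp t ▸ H.mapsTo ih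

theorem Admissible.exists_tendsto_fixedPoint (H : Admissible c α γ) (h0 : p 0 ∈ S)
    (hp : ∀ t, p (t + 1) = cubicMap c α γ (p t)) :
    ∃ z, Tendsto p atTop (𝓝 z) ∧ 0 ≤ z.1 ∧ 0 ≤ z.2 ∧ cubicMap c α γ z = z := by
  have hpS := H.orbit_mem h0 hp
  obtain ⟨z, hz⟩ := exists_tendsto_of_competitive hpS hp
    (fun a ha b hb => H.competitive ha hb)
    (fun a ha b hb h1 h2 h => by
      have := H.weighted_sum_mono ha hb h1.le h2.le
      nlinarith [mul_le_mul_of_nonneg_left h.2.le H.c_nonneg, h.1])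
  have h1 : Tendsto (fun t => p (t + 1)) atTop (𝓝 (cubicMap c α γ z)) := by
    simp only [hp]
    exact (continuous_cubicMap.tendsto z).comp hz
  refine ⟨z, hz, ?_, ?_, tendsto_nhds_unique h1 (hz.comp (tendsto_add_atTop_nat 1))⟩
  · exact ge_of_tendsto' ((continuous_fst.tendsto z).comp hz) fun t => (mem_S_iff.1 (hpS t)).1
  · exact ge_of_tendsto' ((continuous_snd.tendsto z).comp hz) fun t => (mem_S_iff.1 (hpS t)).2.1

theorem Admissible.orbit_snd_pos (H : Admissible c α γ) (h0 : p 0 ∈ S)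
    (hp : ∀ t, p (t + 1) = cubicMap c α γ (p t)) (hpos : 0 < (p 0).2) (t : ℕ) : 0 < (p t).2 := by
  induction t with
  | zero => exact hpos
  | succ t ih =>
    obtain ⟨hx, hy, h⟩ := mem_S_iff.1 (H.orbit_mem h0 hp t)
    rw [hp t]
    exact mul_pos (by positivity) (by linarith [H.two_mul_le_snd_factor hx hy h])

/-- A point of the axis `d₂ = 0` that repels in the transverse direction is not the limit of an
orbit starting off the axis. -/
theorem Admissible.limit_snd_ne_zero (H : Admissible c α γ) (h0 : p 0 ∈ S)
    (hp : ∀ t, p (t + 1) = cubicMap c α γ (p t)) (hpos : 0 < (p 0).2) {z : ℝ × ℝ}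
    (hz : Tendsto p atTop (𝓝 z)) (hrep : γ * z.1 ^ 2 < 1) : z.2 ≠ 0 := by
  intro hz2
  have hy := H.orbit_snd_pos h0 hp hpos
  have hcont : Continuous fun d : ℝ × ℝ => 3 - γ * d.1 ^ 2 - d.2 ^ 2 := by fun_prop
  have hlim : Tendsto (fun t => 3 - γ * (p t).1 ^ 2 - (p t).2 ^ 2) atTop
      (𝓝 (3 - γ * z.1 ^ 2 - z.2 ^ 2)) := (hcont.tendsto z).comp hz
  -- Once this factor exceeds 2, the second coordinate grows, so it cannot tend to 0.
  obtain ⟨N, hN⟩ := eventually_atTop.1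
    (hlim.eventually (lt_mem_nhds (show (2 : ℝ) < 3 - γ * z.1 ^ 2 - z.2 ^ 2 by
      rw [hz2]; linarith)))
  have hmono : Monotone fun n => (p (n + N)).2 := by
    refine monotone_nat_of_le_succ fun n => ?_
    have e : n + 1 + N = n + N + 1 := by ring
    rw [e, hp (n + N)]
    have := hN (n + N) (Nat.le_add_left _ _)
    simp only [cubicMap]
    nlinarith [hy (n + N)]
  have hlim2 : Tendsto (fun n => (p (n + N)).2) atTop (𝓝 0) := by
    rw [← hz2]
    exact (tendsto_add_atTop_iff_nat (f := fun n => (p n).2) N).2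
      ((continuous_snd.tendsto z).comp hz)
  exact absurd (hmono.ge_of_tendsto hlim2 0) (not_le.2 (hy _))

end Orbits

/-! ### Fixed points and their transverse stability. -/

section FixedPoints

theorem cubicMap_fixed_cases {c α γ : ℝ} {z : ℝ × ℝ} (h2 : 0 ≤ z.2)
    (h : cubicMap c α γ z = z) :
    z = (0, 0) ∨ z = consensus ∨ (z.1 ≠ 0 ∧ z.2 = 0 ∧ c - α * z.1 ^ 2 = 2) ∨
      (z.1 ≠ 0 ∧ z.2 ≠ 0 ∧ c * (1 - z.2 ^ 2) - α * z.1 ^ 2 = 2 ∧ z.2 ^ 2 = 1 - γ * z.1 ^ 2) := by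
  obtain ⟨x, y⟩ := z
  simp only [cubicMap, Prod.mk.injEq, consensus] at h h2 ⊢
  obtain ⟨e1, e2⟩ := h
  have f1 : x = 0 ∨ c * (1 - y ^ 2) - α * x ^ 2 = 2 := by
    by_cases hx : x = 0
    · exact .inl hx
    · exact .inr (mul_left_cancel₀ hx (by linarith))
  have f2 : y = 0 ∨ y ^ 2 = 1 - γ * x ^ 2 := by
    by_cases hy : y = 0
    · exact .inl hy
    · exact .inr (mul_left_cancel₀ hy (by linarith))
  by_cases hx : x = 0 <;> by_cases hy : y = 0
  · exact .inl ⟨hx, hy⟩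
  · refine .inr (.inl ⟨hx, ?_⟩)
    have h1 : y ^ 2 = 1 := by simpa [hx, hy] using f2
    nlinarith
  · exact .inr (.inr (.inl ⟨hx, hy, by simpa [hx, hy] using f1⟩))
  · exact .inr (.inr (.inr ⟨hx, hy, f1.resolve_left hx, f2.resolve_left hy⟩))

theorem three_fixed {u : ℝ} (hu : 0 ≤ u) {z : ℝ × ℝ} (h1 : 0 ≤ z.1) (h2 : 0 ≤ z.2)
    (h : cubicMap (3 * u) (u ^ 3) (3 * u ^ 2) z = z) :
    z ∈ starPts3 u ∧ (u < 3 / 4 → z ≠ consensus → z.2 = 0 ∧ 3 * u ^ 2 * z.1 ^ 2 < 1) := by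
  rcases cubicMap_fixed_cases h2 h with rfl | rfl | ⟨hx, hy, e⟩ | ⟨hx, hy, e1, e2⟩
  · exact ⟨.inl rfl, fun _ _ => by simp⟩
  · exact ⟨.inr (.inr (.inr rfl)), fun _ hne => absurd rfl hne⟩
  · have hu' : 0 < u := hu.lt_of_ne' (by rintro rfl; norm_num at e)
    have hx2 : z.1 ^ 2 = (3 * u - 2) / u ^ 3 := by
      field_simp; linarith
    refine ⟨.inr (.inl ⟨?_, Prod.ext ?_ hy⟩), fun hlt _ => ⟨hy, ?_⟩⟩
    · have : 0 ≤ u ^ 3 * z.1 ^ 2 := by positivity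
      linarith
    · rw [← hx2, Real.sqrt_sq h1]
    -- The left side is `3 * (3 * u - 2)`, which is below `u` exactly when `u < 3 / 4`.
    · have : u * (3 * u ^ 2 * z.1 ^ 2) < u * 1 := by linarith
      exact lt_of_mul_lt_mul_left this hu
  · have hu' : 0 < u := hu.lt_of_ne' (by rintro rfl; norm_num at e1)
    rw [e2] at e1
    have hx2 : z.1 ^ 2 = 1 / (4 * u ^ 3) := by
      field_simp; linarith
    have hy2 : z.2 ^ 2 = (4 * u - 3) / (4 * u) := by
      rw [e2, hx2]; field_simp
    have hge : 3 / 4 ≤ u := by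
      have : 0 ≤ z.2 ^ 2 * (4 * u) := by positivity
      rw [hy2, div_mul_cancel₀ _ (by positivity)] at this
      linarith
    refine ⟨.inr (.inr (.inl ⟨hge, Prod.ext ?_ ?_⟩)), fun hlt _ => absurd hge hlt.not_ge⟩
    · rw [← hx2, Real.sqrt_sq h1]
    · rw [← hy2, Real.sqrt_sq h2]

theorem golden_lt_iff {u : ℝ} (hu : 0 ≤ u) : u < (√5 - 1) / 2 ↔ u ^ 2 + u - 1 < 0 := by
  have h5 : √5 ^ 2 = 5 := Real.sq_sqrt (by norm_num)
  have hp : 0 ≤ √5 := Real.sqrt_nonneg 5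
  constructor <;> intro h
  · nlinarith
  · by_contra! h'
    nlinarith

theorem two_fixed {u : ℝ} (hu : 0 ≤ u) {z : ℝ × ℝ} (h1 : 0 ≤ z.1) (h2 : 0 ≤ z.2)
    (h : cubicMap (2 * u + 1) (u ^ 2) (u * (2 + u)) z = z) :
    z ∈ starPts2 u ∧
      (u < (√5 - 1) / 2 → z ≠ consensus → z.2 = 0 ∧ u * (2 + u) * z.1 ^ 2 < 1) := by
  rcases cubicMap_fixed_cases h2 h with rfl | rfl | ⟨hx, hy, e⟩ | ⟨hx, hy, e1, e2⟩
  · exact ⟨.inl rfl, fun _ _ => by simp⟩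
  · exact ⟨.inr (.inr (.inr rfl)), fun _ hne => absurd rfl hne⟩
  · have hu' : 0 < u := hu.lt_of_ne' (by rintro rfl; norm_num at e)
    have hx2 : z.1 ^ 2 = (2 * u - 1) / u ^ 2 := by
      field_simp; linarith
    refine ⟨.inr (.inl ⟨?_, Prod.ext ?_ hy⟩), fun hlt _ => ⟨hy, ?_⟩⟩
    · have : 0 ≤ u ^ 2 * z.1 ^ 2 := by positivity
      linarith
    · rw [← hx2, Real.sqrt_sq h1]
    · have hq := (golden_lt_iff hu).1 hlt
      have e' : u ^ 2 * z.1 ^ 2 = 2 * u - 1 := by linarith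
      -- The inequality `(2 + u) * (2 * u - 1) < u` is equivalent to `u ^ 2 + u - 1 < 0`.
      have : u * (u * (2 + u) * z.1 ^ 2) < u * 1 := by
        calc u * (u * (2 + u) * z.1 ^ 2) = (2 + u) * (u ^ 2 * z.1 ^ 2) := by ring
          _ < u * 1 := by rw [e']; nlinarith
      exact lt_of_mul_lt_mul_left this hu
  · have hu' : 0 < u := hu.lt_of_ne' (by rintro rfl; norm_num [e2] at e1)
    rw [e2] at e1
    have hx2 : z.1 ^ 2 = 1 / (u * (u + 1) ^ 2) := by
      field_simp; linarith
    have hy2 : z.2 ^ 2 = (u ^ 2 + u - 1) / (u + 1) ^ 2 := by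
      rw [e2, hx2]; field_simp; ring
    have hge : (√5 - 1) / 2 ≤ u := by
      rw [← not_lt, golden_lt_iff hu, not_lt]
      have : 0 ≤ z.2 ^ 2 * (u + 1) ^ 2 := by positivity
      rwa [hy2, div_mul_cancel₀ _ (by positivity)] at this
    refine ⟨.inr (.inr (.inl ⟨hge, Prod.ext ?_ ?_⟩)), fun hlt _ => absurd hge hlt.not_ge⟩
    · rw [← hx2, Real.sqrt_sq h1]
    · rw [← hy2, Real.sqrt_sq h2]

end FixedPoints

/-- The absolute values of an orbit converge to a fixed point, which lies off the axis `d₂ = 0` or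
does not repel from it if the orbit starts off the axis. -/
theorem Admissible.absPt_orbit_tendsto {c α γ : ℝ} (H : Admissible c α γ) {d : ℕ → ℝ × ℝ}
    (h0 : absPt (d 0) ∈ S) (hd : ∀ t, d (t + 1) = cubicMap c α γ (d t)) :
    ∃ z, Tendsto (fun t => absPt (d t)) atTop (𝓝 z) ∧ 0 ≤ z.1 ∧ 0 ≤ z.2 ∧
      cubicMap c α γ z = z ∧ (0 < |(d 0).2| → ¬(z.2 = 0 ∧ γ * z.1 ^ 2 < 1)) := by
  have hS t : absPt (d t) ∈ S := by
    induction t with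
    | zero => exact h0
    | succ t ih =>
      rw [hd, H.absPt_cubicMap ih]
      exact H.mapsTo ih
  have hp t : absPt (d (t + 1)) = cubicMap c α γ (absPt (d t)) := by
    rw [hd, H.absPt_cubicMap (hS t)]
  obtain ⟨z, hz, h1, h2, hfix⟩ := H.exists_tendsto_fixedPoint (p := fun t => absPt (d t)) h0 hp
  exact ⟨z, hz, h1, h2, hfix, fun hpos h =>
    H.limit_snd_ne_zero (p := fun t => absPt (d t)) h0 hp hpos hz h.2 h.1⟩

theorem uOf_lt_iff {r a : ℝ} (hr : 0 ≤ r) : uOf r < a ↔ 1 - r < a * (1 + r) := by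
  rw [uOf, div_lt_iff₀ (by linarith)]

end BestOf

theorem proposition4p3 (r : ℝ) (hr0 : 0 ≤ r) (hr1 : r ≤ 1) :
    -- Best-of-three
    ((∀ d : ℕ → ℝ × ℝ, BestOf.absPt (d 0) ∈ BestOf.S →
        (∀ t, d (t + 1) = BestOf.T3 (BestOf.uOf r) (d t)) →
        (∃ z ∈ BestOf.starPts3 (BestOf.uOf r),
          Tendsto (fun t => BestOf.absPt (d t)) atTop (𝓝 z)) ∧
        (BestOf.uOf r < 3 / 4 → ∀ κ > 0, κ < |(d 0).2| →
          Tendsto (fun t => BestOf.absPt (d t)) atTop (𝓝 BestOf.consensus))) ∧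
      (BestOf.uOf r < 3 / 4 ↔ 1 / 7 < r)) ∧
    -- Best-of-two
    ((∀ d : ℕ → ℝ × ℝ, BestOf.absPt (d 0) ∈ BestOf.S →
        (∀ t, d (t + 1) = BestOf.T2 (BestOf.uOf r) (d t)) →
        (∃ z ∈ BestOf.starPts2 (BestOf.uOf r),
          Tendsto (fun t => BestOf.absPt (d t)) atTop (𝓝 z)) ∧
        (BestOf.uOf r < (√5 - 1) / 2 → ∀ κ > 0, κ < |(d 0).2| →
          Tendsto (fun t => BestOf.absPt (d t)) atTop (𝓝 BestOf.consensus))) ∧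
      (BestOf.uOf r < (√5 - 1) / 2 ↔ √5 - 2 < r)) := by
  have hu0 : 0 ≤ BestOf.uOf r := div_nonneg (by linarith) (by linarith)
  have hu1 : BestOf.uOf r ≤ 1 := (div_le_one (by linarith)).2 (by linarith)
  refine ⟨⟨fun d h0 hd => ?_, ?_⟩, fun d h0 hd => ?_, ?_⟩
  · rw [BestOf.T3_eq_cubicMap] at hd
    obtain ⟨z, hz, h1, h2, hfix, hrep⟩ :=
      (BestOf.admissible_three hu0 hu1).absPt_orbit_tendsto h0 hd
    obtain ⟨hmem, hcons⟩ := BestOf.three_fixed hu0 h1 h2 hfix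
    refine ⟨⟨z, hmem, hz⟩, fun hlt κ hκ hκd => ?_⟩
    have : z = BestOf.consensus := by
      by_contra hne
      exact hrep (hκ.trans hκd) (hcons hlt hne)
    exact this ▸ hz
  · rw [BestOf.uOf_lt_iff hr0]
    constructor <;> intro h <;> linarith
  · rw [BestOf.T2_eq_cubicMap] at hd
    obtain ⟨z, hz, h1, h2, hfix, hrep⟩ :=
      (BestOf.admissible_two hu0 hu1).absPt_orbit_tendsto h0 hd
    obtain ⟨hmem, hcons⟩ := BestOf.two_fixed hu0 h1 h2 hfix
    refine ⟨⟨z, hmem, hz⟩, fun hlt κ hκ hκd => ?_⟩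
    have : z = BestOf.consensus := by
      by_contra hne
      exact hrep (hκ.trans hκd) (hcons hlt hne)
    exact this ▸ hz
  · have h5 : √5 ^ 2 = 5 := Real.sq_sqrt (by norm_num)
    have hp : 0 ≤ √5 := Real.sqrt_nonneg 5
    rw [BestOf.uOf_lt_iff hr0]
    constructor <;> intro h <;> nlinarith
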